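/- Let $D\ge 1$, let $\Theta=\Theta_1\times\dots\times\Theta_D\subseteq\mathbb R^D$ with Borel sets $\Theta_i\subseteq\mathbb R$ and the Euclidean norm, let $\pi=\prod_{i=1}^D\pi_i$ be a product prior with Lebesgue density on $\Theta$, let $\ell:\Theta\to\mathbb R$ be the (measurable) log-likelihood of the observed data, and let $\lambda\ge 0$. Write $\mathcal P_2(\Theta)$ for the probability measures on $\Theta$ with a Lebesgue density and finite second moment, $W_2$ for the 2-Wasserstein distance for the Euclidean norm, and, for probability measures $m_i$ on $\Theta_i$ with Lebesgue densities and $m=\prod_i m_i$, write $\mathcal C(m)$ for the set of probability measures with a Lebesgue density whose $i$-th marginal is $m_i$ for every $i$. For a probability measure $q$ with marginals $q_1,\dots,q_D$ put $\Xi(q)=D_{\mathrm{KL}}(q\,\|\,\prod_i q_i)$. Let $q^*_\lambda$ be a $\Xi$-variational posterior, i.e. a minimizer over $q\in\mathcal P_2(\Theta)$ of $$\mathbb E_q[-\ell]+D_{\mathrm{KL}}(q\,\|\,\pi)+\lambda\,\Xi(q)$$ with finite minimal value (the objective is read as $+\infty$ when $\ell$ is not $q$-integrable). Let $m^*_\lambda=\prod_i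 m^*_{\lambda,i}$ be the product of the marginals of $q^*_\lambda$, and let $\tilde m=\prod_i\tilde m_i$ be another product distribution on $\Theta$ whose factors (the pseudomarginals) have Lebesgue densities. Assume: 1. (Lipschitz cost, constant $L\ge 0$.) There are measurable $\phi_i:\Theta_i\to\mathbb R$, integrable under $m^*_{\lambda,i}$ and $\tilde m_i$, such that for all $q\in\mathcal C(m^*_\lambda)$ and $\tilde q\in\mathcal C(\tilde m)$ the function $\ell-\sum_i\phi_i(\theta_i)$ is integrable under $q$ and $\tilde q$ and $$\Big|\int\Big(\ell(\theta)-\sum_{i=1}^D\phi_i(\theta_i)\Big)\,d(q-\tilde q)(\theta)\Big|\le L\,W_2(q,\tilde q).$$ 2. (Transportation cost inequality for $m^*_\lambda$, constant $C\ge 0$.) $W_2(q_1,q_2)\le C\,D_{\mathrm{KL}}(q_1\,\|\,q_2)^{1/4}$ for all $q_1,q_2\in\mathcal C(m^*_\lambda)$ with $D_{\mathrm{KL}}(q_1\,\|\,q_2)<\infty$. Let $\tilde q_\lambda$ be the one-step entropic-optimal-transport correction of $\tilde m$, that is, $$\tilde q_\lambda(d\theta)=\exp\Big(\sum_{i=1}^D\tilde\phi_i(\theta_i)+\tfrac1{\lambda+1}\ell(\theta)\Big)\tilde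 m(d\theta),$$ where the potentials $\tilde\phi_i\in L^1(\tilde m_i)$ are a fixed point of the Sinkhorn updates: for every $i$ and $\tilde m_i$-a.e. $\theta_i$, $$\tilde\phi_i(\theta_i)=-\log Z_i(\theta_i)+\eta_i,\qquad Z_i(\theta_i)=\int\exp\Big(\sum_{j\ne i}\tilde\phi_j(\theta_j)+\tfrac1{\lambda+1}\ell(\theta)\Big)\prod_{j\neq i}\tilde m_j(d\theta_j)<\infty,$$ with $\eta_i=\mathbb E_{\tilde m_i}[\log Z_i]$ for $i<D$ and $\eta_D=0$; or, more generally, let $\tilde q_\lambda$ be any minimizer over $q\in\mathcal C(\tilde m)$ of $\mathbb E_q[-\ell]+(\lambda+1)D_{\mathrm{KL}}(q\,\|\,\tilde m)$ with finite minimal value (same convention as above when $\ell$ is not $q$-integrable). Then $$W_2(q^*_\lambda,\tilde q_\lambda)\le W_2(m^*_\lambda,\tilde m)+2C\,L^{1/4}\,W_2(m^*_\lambda,\tilde m)^{1/4}.$$ -/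

import Mathlib

open MeasureTheory InformationTheory
open scoped ENNReal NNReal

namespace XiVI

noncomputable section

/-- The squared Euclidean distance on `ℝ^D`. (The metric that `Fin D → ℝ` carries by default is the
sup metric, so the Euclidean cost is written out.) -/
def sqDist {D : ℕ} (x y : Fin D → ℝ) : ℝ := ∑ i, (x i - y i) ^ 2

/-- The Wasserstein distance `W₂` on `ℝ^D` with the Euclidean norm, with values in `[0, ∞]`. -/
def W2 {D : ℕ} (μ ν : Measure (Fin D → ℝ)) : ℝ≥0∞ :=
  (⨅ γ ∈ {γ : Measure ((Fin D → ℝ) × (Fin D → ℝ)) | γ.map Prod.fst = μ ∧ γ.map Prod.snd = ν},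
    ∫⁻ p, ENNReal.ofReal (sqDist p.1 p.2) ∂γ) ^ (1 / 2 : ℝ)

/-- `𝒫(Θ)`: probability measures on `Θ` that admit a Lebesgue density, for a Borel set `Θ` of a
Euclidean space; they are regarded as measures on the whole space that give no mass to the
complement of `Θ`. -/
def Dist {X : Type*} [MeasureSpace X] (Θ : Set X) : Set (Measure X) :=
  {q | IsProbabilityMeasure q ∧ q ≪ volume ∧ q Θᶜ = 0}

/-- `𝒫₂(Θ)`: the members of `𝒫(Θ)` with a finite second moment. -/
def Dist2 {D : ℕ} (Θ : Set (Fin D → ℝ)) : Set (Measure (Fin D → ℝ)) :=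
  {q | q ∈ Dist Θ ∧ ∫⁻ θ, ENNReal.ofReal (sqDist θ 0) ∂q < ∞}

/-- The `i`-th marginal `q_i` of `q`. -/
def marginal {D : ℕ} (q : Measure (Fin D → ℝ)) (i : Fin D) : Measure ℝ :=
  q.map (fun θ => θ i)

/-- `𝒞(m_1, …, m_D)`: the joint distributions (with a Lebesgue density) whose marginals are
`m_1, …, m_D`. -/
def Couplings {D : ℕ} (m : Fin D → Measure ℝ) : Set (Measure (Fin D → ℝ)) :=
  {q | IsProbabilityMeasure q ∧ q ≪ volume ∧ ∀ i, marginal q i = m i}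

/-- The expressivity functional `Ξ(q)`: the Kullback-Leibler divergence of `q` from the product of
its marginals. -/
def expressivity {D : ℕ} (q : Measure (Fin D → ℝ)) : ℝ≥0∞ :=
  klDiv q (Measure.pi (marginal q))

open Classical in
/-- `𝔼_q[-ℓ] + R`, with value `+∞` if `ℓ` is not `q`-integrable. -/
def penalizedLoss {D : ℕ} (ℓ : (Fin D → ℝ) → ℝ) (R : ℝ≥0∞) (q : Measure (Fin D → ℝ)) : EReal :=
  if Integrable ℓ q then ((∫ θ, -ℓ θ ∂q : ℝ) : EReal) + (R : EReal) else ⊤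

/-- The `Ξ`-variational objective `𝔼_q[-ℓ] + KL(q ‖ π) + lam Ξ(q)`, to be minimized. -/
def xiObjective {D : ℕ} (ℓ : (Fin D → ℝ) → ℝ) (π : Measure (Fin D → ℝ)) (lam : ℝ≥0)
    (q : Measure (Fin D → ℝ)) : EReal :=
  penalizedLoss ℓ (klDiv q π + lam * expressivity q) q

/-- `q` is a `Ξ`-variational posterior: a minimizer of the `Ξ`-variational objective over `𝒫₂(Θ)`,
the minimum being finite. -/
def IsXiPosterior {D : ℕ} (Θ : Set (Fin D → ℝ)) (ℓ : (Fin D → ℝ) → ℝ) (π : Measure (Fin D → ℝ))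
    (lam : ℝ≥0) (q : Measure (Fin D → ℝ)) : Prop :=
  q ∈ Dist2 Θ ∧ xiObjective ℓ π lam q ≠ ⊤ ∧
    ∀ q' ∈ Dist2 Θ, xiObjective ℓ π lam q ≤ xiObjective ℓ π lam q'

/-- The objective `𝔼_q[-ℓ] + (lam + 1) KL(q ‖ m)` of the entropic optimal transport problem with
marginals `m_1, …, m_D`, where `m = ∏ m_i`. -/
def eotObjective {D : ℕ} (ℓ : (Fin D → ℝ) → ℝ) (lam : ℝ≥0) (m : Fin D → Measure ℝ)
    (q : Measure (Fin D → ℝ)) : EReal :=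
  penalizedLoss ℓ ((lam + 1) * klDiv q (Measure.pi m)) q

/-- `q` is an optimal coupling for the entropic optimal transport problem with marginals
`m_1, …, m_D`, the minimum being finite. -/
def IsEOTOptimizer {D : ℕ} (ℓ : (Fin D → ℝ) → ℝ) (lam : ℝ≥0) (m : Fin D → Measure ℝ)
    (q : Measure (Fin D → ℝ)) : Prop :=
  q ∈ Couplings m ∧ eotObjective ℓ lam m q ≠ ⊤ ∧
    ∀ q' ∈ Couplings m, eotObjective ℓ lam m q ≤ eotObjective ℓ lam m q'

/-- `exp (Λ(t, θ_{-i}))` with `Λ(t, θ_{-i}) = ∑_{j ≠ i} φ_j(θ_j) + ℓ(t, θ_{-i}) / (lam + 1)`. It does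
not depend on the coordinate `θ_i`, so that its mean under `∏ m_j` is the one under
`∏_{j ≠ i} m_j`. -/
def sinkhornKernel {D : ℕ} (ℓ : (Fin D → ℝ) → ℝ) (lam : ℝ≥0) (φ : Fin D → ℝ → ℝ) (i : Fin D)
    (t : ℝ) (θ : Fin D → ℝ) : ℝ :=
  Real.exp ((∑ j ∈ Finset.univ.erase i, φ j (θ j)) + ℓ (Function.update θ i t) / (lam + 1))

/-- `log 𝔼_{m_{-i}} exp (Λ(t, θ_{-i}))`. -/
def sinkhornLog {D : ℕ} (ℓ : (Fin D → ℝ) → ℝ) (lam : ℝ≥0) (m : Fin D → Measure ℝ)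
    (φ : Fin D → ℝ → ℝ) (i : Fin D) (t : ℝ) : ℝ :=
  Real.log (∫ θ, sinkhornKernel ℓ lam φ i t θ ∂(Measure.pi m))

/-- The Sinkhorn update of the `i`-th potential, with the centring constant `η_i` for all but the
last index. -/
def sinkhornUpdate {D : ℕ} (ℓ : (Fin D → ℝ) → ℝ) (lam : ℝ≥0) (m : Fin D → Measure ℝ)
    (φ : Fin D → ℝ → ℝ) (i : Fin D) (t : ℝ) : ℝ :=
  -sinkhornLog ℓ lam m φ i t +
    if (i : ℕ) + 1 < D then ∫ s, sinkhornLog ℓ lam m φ i s ∂(m i) else 0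

/-- `φ_1, …, φ_D` are the potentials that the (converged) Sinkhorn algorithm returns for the
marginals `m_1, …, m_D`: `φ_i` lies in `L¹(m_i)`, and every Sinkhorn update is defined at `φ` and
leaves it fixed. -/
structure IsSinkhornPotential {D : ℕ} (ℓ : (Fin D → ℝ) → ℝ) (lam : ℝ≥0) (m : Fin D → Measure ℝ)
    (φ : Fin D → ℝ → ℝ) : Prop where
  measurable : ∀ i, Measurable (φ i)
  integrable : ∀ i, Integrable (φ i) (m i)
  kernel_integrable : ∀ i, ∀ᵐ t ∂(m i), Integrable (sinkhornKernel ℓ lam φ i t) (Measure.pi m)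
  fixed : ∀ i, ∀ᵐ t ∂(m i), φ i t = sinkhornUpdate ℓ lam m φ i t

/-- The output of the one-step entropic correction of the pseudomarginals `m_1, …, m_D`:
`q(θ) = exp (∑ φ_i(θ_i) + ℓ(θ) / (lam + 1)) ∏ m_i(θ_i)` with the Sinkhorn potentials `φ_i`. -/
def IsOneStepOutput {D : ℕ} (ℓ : (Fin D → ℝ) → ℝ) (lam : ℝ≥0) (m : Fin D → Measure ℝ)
    (q : Measure (Fin D → ℝ)) : Prop :=
  ∃ φ : Fin D → ℝ → ℝ, IsSinkhornPotential ℓ lam m φ ∧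
    q = (Measure.pi m).withDensity
      (fun θ => ENNReal.ofReal (Real.exp ((∑ i, φ i (θ i)) + ℓ θ / (lam + 1))))

/-- The Lipschitz cost assumption with constant `L` for the marginals `m` and `m'`: for some
`φ_i`, `|∫ (ℓ - ∑ φ_i) d(q - q')| ≤ L W₂(q, q')` for all couplings `q` of `m` and `q'` of `m'`, all
the integrals being defined. -/
def LipschitzCost {D : ℕ} (ℓ : (Fin D → ℝ) → ℝ) (L : ℝ≥0) (m m' : Fin D → Measure ℝ) : Prop :=
  ∃ φ : Fin D → ℝ → ℝ,
    (∀ i, Measurable (φ i) ∧ Integrable (φ i) (m i) ∧ Integrable (φ i) (m' i)) ∧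
    ∀ q ∈ Couplings m, ∀ q' ∈ Couplings m',
      Integrable (fun θ => ℓ θ - ∑ i, φ i (θ i)) q ∧
      Integrable (fun θ => ℓ θ - ∑ i, φ i (θ i)) q' ∧
      ENNReal.ofReal |(∫ θ, (ℓ θ - ∑ i, φ i (θ i)) ∂q) - ∫ θ, (ℓ θ - ∑ i, φ i (θ i)) ∂q'|
        ≤ L * W2 q q'

/-- The transportation cost inequality with constant `C` for the marginals `m`:
`W₂(q₁, q₂) ≤ C KL(q₁ ‖ q₂)^{1/4}` for all couplings `q₁`, `q₂` of `m`. -/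
def TransportCost {D : ℕ} (C : ℝ≥0) (m : Fin D → Measure ℝ) : Prop :=
  ∀ q₁ ∈ Couplings m, ∀ q₂ ∈ Couplings m, klDiv q₁ q₂ ≠ ∞ →
    W2 q₁ q₂ ≤ C * klDiv q₁ q₂ ^ (1 / 4 : ℝ)

end

end XiVI

/-!
Write `m` for the marginals of the posterior `q*`, `m'` for the pseudomarginals, and
`J(q) = 𝔼_q[-ℓ] + (lam + 1) KL(q ‖ ∏ m_i)`. For couplings `q` of `m`, `KL(q ‖ π)` and `KL(q ‖ ∏ m_i)`
differ by a constant (`exists_toReal_klDiv_pi_eq_add`), so that `q*` minimizes `J` over these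
couplings, while `q̃` minimizes the corresponding functional `J'` over the couplings of `m'`; for the
one-step correction this is the Gibbs variational principle
(`IsOneStepOutput.isEOTOptimizer`).

The two problems are compared by shadows (`exists_shadow`). Given a coupling of `∏ m_i` and `∏ m'_i`
with cost `δ ^ 2`, moving every coordinate of `q̃` independently according to it gives a coupling `s`
of `m` with `W₂(s, q̃) ≤ δ`, and `KL(s ‖ ∏ m_i) ≤ KL(q̃ ‖ ∏ m'_i)` by data processing; in the same way
`q*` has a shadow `s'` among the couplings of `m'`. With the Lipschitz condition, up to a constant that
cancels, `J(s) ≤ J'(q̃) + L δ ≤ J'(s') + L δ ≤ J(q*) + 2 L δ`.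

Let `h` be the midpoint of `q*` and `s`. Comparing `J(q*)` with `J(h)`, the compensation identity
(`two_mul_klDiv_midpointMeasure`) yields
`KL(q* ‖ h) + KL(s ‖ h) ≤ J(s) - J(q*) ≤ 2 L δ` (`IsXiPosterior.klDiv_midpoint_le`). The transportation
cost inequality for both pairs and the concavity of the fourth root give
`W₂(q*, s) ≤ 2 C (L δ) ^ (1 / 4)`, and the triangle inequality gives the bound on `W₂(q*, q̃)`
(`W2_posterior_le_of_coupling`). Finally `δ` tends to `W₂(∏ m_i, ∏ m'_i)`.
-/

namespace XiVI

/-! ### Log-likelihood ratios and the Kullback-Leibler divergence -/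

section KullbackLeibler

variable {α : Type*} {mα : MeasurableSpace α}

/-- Chain rule for Radon-Nikodym derivatives, in logarithmic form. -/
theorem llr_ae_eq_add {μ ν ρ : Measure α} [SigmaFinite μ] [SigmaFinite ν] [SigmaFinite ρ]
    (hμν : μ ≪ ν) (hνρ : ν ≪ ρ) :
    llr μ ρ =ᵐ[μ] fun x => llr μ ν x + llr ν ρ x := by
  filter_upwards [(hμν.trans hνρ) (Measure.rnDeriv_mul_rnDeriv hμν (κ := ρ)),
    Measure.rnDeriv_pos hμν, hμν (Measure.rnDeriv_ne_top μ ν),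
    hμν (Measure.rnDeriv_pos hνρ), (hμν.trans hνρ) (Measure.rnDeriv_ne_top ν ρ)]
    with x h1 h2 h3 h4 h5
  simp only [llr]
  rw [← h1, Pi.mul_apply, ENNReal.toReal_mul, Real.log_mul]
  · exact (ENNReal.toReal_pos h2.ne' h3).ne'
  · exact (ENNReal.toReal_pos h4.ne' h5).ne'

theorem rnDeriv_le_of_le_smul {μ ν : Measure α} [SigmaFinite μ] [IsFiniteMeasure ν] {c : ℝ≥0}
    (h : μ ≤ c • ν) : ∀ᵐ x ∂ν, μ.rnDeriv ν x ≤ c := by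
  refine ae_le_of_forall_setLIntegral_le_of_sigmaFinite (Measure.measurable_rnDeriv μ ν) ?_
  intro s _ _
  calc ∫⁻ x in s, μ.rnDeriv ν x ∂ν ≤ μ s := Measure.setLIntegral_rnDeriv_le s
    _ ≤ (c • ν) s := h s
    _ = ∫⁻ _ in s, (c : ℝ≥0∞) ∂ν := by
        rw [setLIntegral_const, Measure.smul_apply, ENNReal.smul_def, smul_eq_mul]

theorem klDiv_ne_top_of_le_smul {μ ν : Measure α} [IsFiniteMeasure μ] [IsFiniteMeasure ν] {c : ℝ≥0}
    (h : μ ≤ c • ν) : klDiv μ ν ≠ ∞ := by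
  have hac : μ ≪ ν :=
    (Measure.absolutelyContinuous_of_le h).trans (Measure.smul_absolutelyContinuous)
  refine klDiv_ne_top hac ?_
  rw [← integrable_klFun_rnDeriv_iff hac]
  obtain ⟨B, hB⟩ := (isCompact_Icc (a := (0 : ℝ)) (b := c)).exists_bound_of_continuousOn
    continuous_klFun.continuousOn
  refine Integrable.of_bound (C := B) ?_ ?_
  · exact (continuous_klFun.measurable.comp
      (Measure.measurable_rnDeriv μ ν).ennreal_toReal).aestronglyMeasurable
  · filter_upwards [rnDeriv_le_of_le_smul h] with x hx
    refine hB _ ⟨ENNReal.toReal_nonneg, ?_⟩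
    exact ENNReal.toReal_le_of_le_ofReal c.2 (by simpa using hx)

/-- The midpoint of two measures. -/
noncomputable def midpointMeasure (μ ν : Measure α) : Measure α := (2⁻¹ : ℝ≥0) • (μ + ν)

instance (μ ν : Measure α) [IsProbabilityMeasure μ] [IsProbabilityMeasure ν] :
    IsProbabilityMeasure (midpointMeasure μ ν) := by
  constructor
  simp only [midpointMeasure, Measure.smul_apply, Measure.add_apply, measure_univ,
    ENNReal.smul_def, smul_eq_mul]
  rw [one_add_one_eq_two, ENNReal.coe_inv (by norm_num)]
  exact ENNReal.inv_mul_cancel (by norm_num) (by norm_num)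

theorem two_smul_midpointMeasure (μ ν : Measure α) :
    (2 : ℝ≥0) • midpointMeasure μ ν = μ + ν := by
  simp [midpointMeasure, smul_smul]

theorem le_two_smul_midpointMeasure_left (μ ν : Measure α) :
    μ ≤ (2 : ℝ≥0) • midpointMeasure μ ν := by
  rw [two_smul_midpointMeasure]; exact Measure.le_add_right le_rfl

theorem le_two_smul_midpointMeasure_right (μ ν : Measure α) :
    ν ≤ (2 : ℝ≥0) • midpointMeasure μ ν := by
  rw [two_smul_midpointMeasure]; exact Measure.le_add_left le_rfl

theorem midpointMeasure_absolutelyContinuous {μ ν ρ : Measure α} (hμ : μ ≪ ρ) (hν : ν ≪ ρ) :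
    midpointMeasure μ ν ≪ ρ :=
  Measure.smul_absolutelyContinuous.trans
    (Measure.AbsolutelyContinuous.add_left hμ hν)

theorem midpointMeasure_self (μ : Measure α) : midpointMeasure μ μ = μ := by
  ext s _
  simp only [midpointMeasure, Measure.smul_apply, Measure.add_apply, ENNReal.smul_def, smul_eq_mul]
  rw [← two_mul, ← mul_assoc, ENNReal.coe_inv (by norm_num)]
  simp [ENNReal.inv_mul_cancel]

theorem map_midpointMeasure {β : Type*} {mβ : MeasurableSpace β} {f : α → β} (hf : Measurable f)
    (μ ν : Measure α) :
    (midpointMeasure μ ν).map f = midpointMeasure (μ.map f) (ν.map f) := by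
  rw [midpointMeasure, Measure.map_smul, Measure.map_add _ _ hf, midpointMeasure]

theorem integrable_midpointMeasure {μ ν : Measure α} {f : α → ℝ} (hμ : Integrable f μ)
    (hν : Integrable f ν) : Integrable f (midpointMeasure μ ν) :=
  (hμ.add_measure hν).smul_measure_nnreal

theorem two_mul_integral_midpointMeasure {μ ν : Measure α} {f : α → ℝ} (hμ : Integrable f μ)
    (hν : Integrable f ν) :
    2 * ∫ x, f x ∂(midpointMeasure μ ν) = (∫ x, f x ∂μ) + ∫ x, f x ∂ν := by
  rw [← integral_add_measure hμ hν, midpointMeasure, integral_smul_nnreal_measure]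
  simp [NNReal.smul_def]

/-- The compensation identity: the relative entropy is strictly convex, with modulus given by the
relative entropies with respect to the midpoint. -/
theorem two_mul_klDiv_midpointMeasure {μ ν ρ : Measure α} [IsProbabilityMeasure μ]
    [IsProbabilityMeasure ν] [IsProbabilityMeasure ρ]
    (hμ : klDiv μ ρ ≠ ∞) (hν : klDiv ν ρ ≠ ∞) :
    klDiv (midpointMeasure μ ν) ρ ≠ ∞ ∧
      2 * (klDiv (midpointMeasure μ ν) ρ).toReal + (klDiv μ (midpointMeasure μ ν)).toReal
          + (klDiv ν (midpointMeasure μ ν)).toReal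
        = (klDiv μ ρ).toReal + (klDiv ν ρ).toReal := by
  set h := midpointMeasure μ ν with hh
  obtain ⟨hμρ, hμi⟩ := klDiv_ne_top_iff.1 hμ
  obtain ⟨hνρ, hνi⟩ := klDiv_ne_top_iff.1 hν
  have hhρ : h ≪ ρ := midpointMeasure_absolutelyContinuous hμρ hνρ
  obtain ⟨hμh, hμhi⟩ := klDiv_ne_top_iff.1
    (klDiv_ne_top_of_le_smul (le_two_smul_midpointMeasure_left μ ν))
  obtain ⟨hνh, hνhi⟩ := klDiv_ne_top_iff.1
    (klDiv_ne_top_of_le_smul (le_two_smul_midpointMeasure_right μ ν))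
  have eμ : llr h ρ =ᵐ[μ] fun x => llr μ ρ x - llr μ h x := by
    filter_upwards [llr_ae_eq_add hμh hhρ] with x hx
    rw [hx]; ring
  have eν : llr h ρ =ᵐ[ν] fun x => llr ν ρ x - llr ν h x := by
    filter_upwards [llr_ae_eq_add hνh hhρ] with x hx
    rw [hx]; ring
  have iμ : Integrable (llr h ρ) μ := (hμi.sub hμhi).congr eμ.symm
  have iν : Integrable (llr h ρ) ν := (hνi.sub hνhi).congr eν.symm
  refine ⟨klDiv_ne_top hhρ (integrable_midpointMeasure iμ iν), ?_⟩
  rw [toReal_klDiv_of_measure_eq hhρ (by simp), toReal_klDiv_of_measure_eq hμh (by simp),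
    toReal_klDiv_of_measure_eq hνh (by simp), toReal_klDiv_of_measure_eq hμρ (by simp),
    toReal_klDiv_of_measure_eq hνρ (by simp), two_mul_integral_midpointMeasure iμ iν,
    integral_congr_ae eμ, integral_congr_ae eν, integral_sub hμi hμhi, integral_sub hνi hνhi]
  ring

/-- Gibbs variational principle: `∫ log (dσ/dρ) dμ ≤ KL(μ ‖ ρ)` for probability measures. -/
theorem integral_llr_le_toReal_klDiv {μ σ ρ : Measure α} [IsProbabilityMeasure μ]
    [IsProbabilityMeasure σ] [IsProbabilityMeasure ρ] (hρσ : ρ ≪ σ) (hσρ : σ ≪ ρ)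
    (hμ : klDiv μ ρ ≠ ∞) (hi : Integrable (llr σ ρ) μ) :
    ∫ x, llr σ ρ x ∂μ ≤ (klDiv μ ρ).toReal := by
  obtain ⟨hμρ, hμi⟩ := klDiv_ne_top_iff.1 hμ
  have hμσ := hμρ.trans hρσ
  have e : llr μ σ =ᵐ[μ] fun x => llr μ ρ x - llr σ ρ x := by
    filter_upwards [llr_ae_eq_add hμσ hσρ] with x hx
    rw [hx]; ring
  have h0 : 0 ≤ ∫ x, llr μ σ x ∂μ := by
    rw [← toReal_klDiv_of_measure_eq hμσ (by simp)]; exact ENNReal.toReal_nonneg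
  rw [integral_congr_ae e, integral_sub hμi hi] at h0
  rw [toReal_klDiv_of_measure_eq hμρ (by simp)]
  linarith

theorem llr_withDensity_ofReal_exp {ρ : Measure α} [SigmaFinite ρ] {f : α → ℝ}
    (hf : Measurable f) :
    llr (ρ.withDensity fun x => ENNReal.ofReal (Real.exp (f x))) ρ =ᵐ[ρ] f := by
  filter_upwards [Measure.rnDeriv_withDensity ρ
    (f := fun x => ENNReal.ofReal (Real.exp (f x))) (by fun_prop)] with x hx
  simp only [llr]
  rw [hx, ENNReal.toReal_ofReal (Real.exp_nonneg _), Real.log_exp]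

/-- Reweighting by a function of `f` changes the relative entropy by as much as reweighting the
image measure under `f`. -/
theorem klDiv_withDensity_comp {β : Type*} {mβ : MeasurableSpace β} {f : α → β}
    (hf : Measurable f) {ρ : Measure α} [IsFiniteMeasure ρ] {g : β → ℝ≥0∞} (hg : Measurable g)
    [IsFiniteMeasure ((ρ.map f).withDensity g)] [IsFiniteMeasure (ρ.withDensity (g ∘ f))] :
    klDiv (ρ.withDensity (g ∘ f)) ρ = klDiv ((ρ.map f).withDensity g) (ρ.map f) := by
  rw [klDiv_eq_lintegral_klFun_of_ac (withDensity_absolutelyContinuous _ _),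
    klDiv_eq_lintegral_klFun_of_ac (withDensity_absolutelyContinuous _ _)]
  have h1 := Measure.rnDeriv_withDensity ρ (hg.comp hf)
  have h2 := Measure.rnDeriv_withDensity (ρ.map f) hg
  have hm : Measurable fun y => ENNReal.ofReal (klFun (g y).toReal) :=
    (continuous_klFun.measurable.comp hg.ennreal_toReal).ennreal_ofReal
  calc _ = ∫⁻ x, ENNReal.ofReal (klFun (g (f x)).toReal) ∂ρ := by
        refine lintegral_congr_ae ?_
        filter_upwards [h1] with x hx
        rw [hx]; rfl
    _ = ∫⁻ y, ENNReal.ofReal (klFun (g y).toReal) ∂(ρ.map f) := (lintegral_map hm hf).symm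
    _ = _ := by
        refine lintegral_congr_ae ?_
        filter_upwards [h2] with x hx
        rw [hx]

end KullbackLeibler

/-! ### Product measures and couplings -/

section Products

open Set

theorem absolutelyContinuous_pi {n : ℕ} {X : Fin n → Type*} [∀ i, MeasurableSpace (X i)]
    {μ ν : ∀ i, Measure (X i)} [∀ i, SigmaFinite (μ i)] [∀ i, SigmaFinite (ν i)]
    (h : ∀ i, μ i ≪ ν i) : Measure.pi μ ≪ Measure.pi ν := by
  induction n with
  | zero =>
    rw [Measure.pi_of_empty μ finZeroElim, Measure.pi_of_empty ν finZeroElim]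
  | succ n ih =>
    have hμ := (measurePreserving_piFinSuccAbove μ 0).symm
    have hν := (measurePreserving_piFinSuccAbove ν 0).symm
    rw [← hμ.map_eq, ← hν.map_eq]
    exact ((h 0).prod (ih fun j => h _)).map (MeasurableEquiv.measurable _)

theorem restrict_absolutelyContinuous_of_rnDeriv_ne_zero {α : Type*} {mα : MeasurableSpace α}
    {μ ν : Measure α} [SigmaFinite μ] [SigmaFinite ν] (h : μ ≪ ν) :
    ν.restrict {x | μ.rnDeriv ν x ≠ 0} ≪ μ := by
  have hm := Measure.measurable_rnDeriv μ ν
  have hs : MeasurableSet {x | μ.rnDeriv ν x ≠ 0} := (hm (measurableSet_singleton 0)).compl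
  refine (withDensity_absolutelyContinuous' hm.aemeasurable
    ((ae_restrict_iff' hs).2 (ae_of_all _ fun x hx => hx))).trans ?_
  rw [← restrict_withDensity hs, Measure.withDensity_rnDeriv_eq _ _ h]
  exact Measure.restrict_le_self.absolutelyContinuous

/-- A measure with a density with respect to some product measure has a density with respect to
the product of its own marginals: it does not charge the zero set of a marginal density. -/
theorem absolutelyContinuous_pi_marginal {D : ℕ} {q : Measure (Fin D → ℝ)} [IsFiniteMeasure q]
    {ν : Fin D → Measure ℝ} [∀ i, SigmaFinite (ν i)] (hq : q ≪ Measure.pi ν) :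
    q ≪ Measure.pi (marginal q) := by
  have : ∀ i, IsFiniteMeasure (marginal q i) := fun i => by unfold marginal; infer_instance
  have hac : ∀ i, marginal q i ≪ ν i := fun i =>
    (hq.map (measurable_pi_apply i)).trans (Measure.quasiMeasurePreserving_eval ν i).2
  set S : Fin D → Set ℝ := fun i => {x | (marginal q i).rnDeriv (ν i) x ≠ 0} with hS
  have hSm : ∀ i, MeasurableSet (S i) := fun i =>
    (Measure.measurable_rnDeriv _ _ (measurableSet_singleton 0)).compl
  have h1 : (Measure.pi ν).restrict (univ.pi S) ≪ Measure.pi (marginal q) := by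
    rw [Measure.restrict_pi_pi]
    exact absolutelyContinuous_pi fun i =>
      restrict_absolutelyContinuous_of_rnDeriv_ne_zero (hac i)
  have h2 : q (univ.pi S)ᶜ = 0 := by
    have : (univ.pi S)ᶜ = ⋃ i, (fun θ : Fin D → ℝ => θ i) ⁻¹' (S i)ᶜ := by
      ext θ; simp [Set.mem_pi]
    rw [this, measure_iUnion_null_iff]
    intro i
    rw [← Measure.map_apply (measurable_pi_apply i) (hSm i).compl]
    have := Measure.rnDeriv_pos (hac i)
    rw [ae_iff] at this
    convert! this using 2
    ext x; simp [hS]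
  refine Measure.AbsolutelyContinuous.mk fun N hN hN0 => ?_
  have h3 := h1 hN0
  rw [Measure.restrict_apply hN] at h3
  exact measure_mono_null (fun x hx => by
    by_cases h : x ∈ univ.pi S
    · exact Or.inl ⟨hx, h⟩
    · exact Or.inr h) (measure_union_null (hq h3) h2)

theorem isProbabilityMeasure_of_mem_couplings {D : ℕ} {m : Fin D → Measure ℝ}
    {q : Measure (Fin D → ℝ)} (hq : q ∈ Couplings m) (i : Fin D) : IsProbabilityMeasure (m i) := by
  have := hq.1
  rw [← hq.2.2 i]
  exact Measure.isProbabilityMeasure_map (measurable_pi_apply i).aemeasurable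

theorem absolutelyContinuous_pi_of_mem_couplings {D : ℕ} {m : Fin D → Measure ℝ}
    {q : Measure (Fin D → ℝ)} (hq : q ∈ Couplings m) : q ≪ Measure.pi m := by
  have := hq.1
  have h : q ≪ Measure.pi fun _ : Fin D => (volume : Measure ℝ) := hq.2.1
  have hm : marginal q = m := funext hq.2.2
  rw [← hm]
  exact absolutelyContinuous_pi_marginal h

theorem measurePreserving_eval_of_mem_couplings {D : ℕ} {m : Fin D → Measure ℝ}
    {q : Measure (Fin D → ℝ)} (hq : q ∈ Couplings m) (i : Fin D) :
    MeasurePreserving (fun θ : Fin D → ℝ => θ i) q (m i) :=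
  ⟨measurable_pi_apply i, hq.2.2 i⟩

theorem integrable_sum_of_mem_couplings {D : ℕ} {m : Fin D → Measure ℝ}
    {q : Measure (Fin D → ℝ)} (hq : q ∈ Couplings m) {f : Fin D → ℝ → ℝ}
    (hf : ∀ i, Integrable (f i) (m i)) : Integrable (fun θ => ∑ i, f i (θ i)) q :=
  integrable_finsetSum _ fun i _ =>
    (measurePreserving_eval_of_mem_couplings hq i).integrable_comp_of_integrable (hf i)

theorem integral_sum_of_mem_couplings {D : ℕ} {m : Fin D → Measure ℝ}
    {q : Measure (Fin D → ℝ)} (hq : q ∈ Couplings m) {f : Fin D → ℝ → ℝ}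
    (hf : ∀ i, Integrable (f i) (m i)) :
    ∫ θ, ∑ i, f i (θ i) ∂q = ∑ i, ∫ t, f i t ∂(m i) := by
  have hi : ∀ i ∈ Finset.univ, Integrable (fun θ : Fin D → ℝ => f i (θ i)) q := fun i _ =>
    (measurePreserving_eval_of_mem_couplings hq i).integrable_comp_of_integrable (hf i)
  rw [integral_finsetSum _ hi]
  refine Finset.sum_congr rfl fun i _ => ?_
  have h := measurePreserving_eval_of_mem_couplings hq i
  rw [← h.map_eq, integral_map h.measurable.aemeasurable]
  rw [h.map_eq]; exact (hf i).aestronglyMeasurable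

theorem midpointMeasure_mem_couplings {D : ℕ} {m : Fin D → Measure ℝ}
    {q q' : Measure (Fin D → ℝ)} (hq : q ∈ Couplings m) (hq' : q' ∈ Couplings m) :
    midpointMeasure q q' ∈ Couplings m := by
  have := hq.1
  have := hq'.1
  refine ⟨inferInstance, midpointMeasure_absolutelyContinuous hq.2.1 hq'.2.1, fun i => ?_⟩
  have h1 := hq.2.2 i
  have h2 := hq'.2.2 i
  unfold marginal at *
  rw [map_midpointMeasure (measurable_pi_apply i), h1, h2, midpointMeasure_self]

theorem pi_withDensity {D : ℕ} (π : Fin D → Measure ℝ) [∀ i, IsProbabilityMeasure (π i)]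
    (f : Fin D → ℝ → ℝ≥0∞) (hf : ∀ i, Measurable (f i))
    [∀ i, SigmaFinite ((π i).withDensity (f i))] :
    Measure.pi (fun i => (π i).withDensity (f i))
      = (Measure.pi π).withDensity fun θ => ∏ i, f i (θ i) := by
  refine Measure.pi_eq fun s hs => ?_
  rw [withDensity_apply _ (MeasurableSet.univ_pi hs), ← lintegral_indicator (MeasurableSet.univ_pi hs)]
  have h : ∀ θ : Fin D → ℝ, (univ.pi s).indicator (fun θ => ∏ i, f i (θ i)) θ
      = ∏ i, (s i).indicator (f i) (θ i) := by
    intro θ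
    by_cases h : θ ∈ univ.pi s
    · rw [indicator_of_mem h]
      exact Finset.prod_congr rfl fun i _ => (indicator_of_mem (h i (mem_univ i)) _).symm
    · rw [indicator_of_notMem h]
      simp only [Set.mem_pi, mem_univ, true_implies, not_forall] at h
      obtain ⟨i, hi⟩ := h
      exact (Finset.prod_eq_zero (Finset.mem_univ i) (indicator_of_notMem hi _)).symm
  simp_rw [h]
  have hm : ∀ i, Measurable ((s i).indicator (f i)) := fun i => (hf i).indicator (hs i)
  rw [ProbabilityTheory.lintegral_prod_eq_prod_lintegral_of_indepFun Finset.univ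
    (fun i (θ : Fin D → ℝ) => (s i).indicator (f i) (θ i))
    (ProbabilityTheory.iIndepFun_pi fun i => (hm i).aemeasurable)
    (fun i => (hm i).comp (measurable_pi_apply i))]
  refine Finset.prod_congr rfl fun i _ => ?_
  rw [withDensity_apply _ (hs i), ← lintegral_indicator (hs i)]
  exact (measurePreserving_eval π i).lintegral_comp (hm i)

theorem llr_pi {D : ℕ} {m π : Fin D → Measure ℝ} [∀ i, IsProbabilityMeasure (m i)]
    [∀ i, IsProbabilityMeasure (π i)] (h : ∀ i, m i ≪ π i) :
    llr (Measure.pi m) (Measure.pi π) =ᵐ[Measure.pi m] fun θ => ∑ i, llr (m i) (π i) (θ i) := by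
  have hd : ∀ i, (π i).withDensity ((m i).rnDeriv (π i)) = m i := fun i =>
    Measure.withDensity_rnDeriv_eq _ _ (h i)
  have : ∀ i, SigmaFinite ((π i).withDensity ((m i).rnDeriv (π i))) := fun i => by
    rw [hd i]; infer_instance
  have hm := pi_withDensity π (fun i => (m i).rnDeriv (π i))
    fun i => Measure.measurable_rnDeriv _ _
  simp_rw [hd] at hm
  have hF : Measurable fun θ : Fin D → ℝ => ∏ i, (m i).rnDeriv (π i) (θ i) :=
    Finset.measurable_prod _ fun i _ =>
      (Measure.measurable_rnDeriv _ _).comp (measurable_pi_apply i)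
  have h1 := absolutelyContinuous_pi h (Measure.rnDeriv_withDensity (Measure.pi π) hF)
  rw [← hm] at h1
  have h2 : ∀ᵐ θ ∂(Measure.pi m), ∀ i, 0 < (m i).rnDeriv (π i) (θ i) ∧
      (m i).rnDeriv (π i) (θ i) ≠ ∞ := by
    rw [ae_all_iff]
    intro i
    exact (measurePreserving_eval m i).quasiMeasurePreserving.ae
      ((Measure.rnDeriv_pos (h i)).and (h i (Measure.rnDeriv_ne_top _ _)))
  filter_upwards [h1, h2] with θ h1 h2
  simp only [llr]
  rw [h1, ENNReal.toReal_prod, Real.log_prod]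
  exact fun i _ => (ENNReal.toReal_pos (h2 i).1.ne' (h2 i).2).ne'

/-- For couplings `q` of `m`, the relative entropies with respect to `∏ m_i` and to another product
measure differ by the constant `K = KL(∏ m_i ‖ ∏ π_i)`. A single coupling `p` of finite relative
entropy with respect to `∏ π_i` ensures that this constant is finite, by data processing. -/
theorem exists_toReal_klDiv_pi_eq_add {D : ℕ} {m π : Fin D → Measure ℝ}
    [∀ i, IsProbabilityMeasure (m i)] [∀ i, IsProbabilityMeasure (π i)]
    {p : Measure (Fin D → ℝ)} (hp : p ∈ Couplings m) (hfin : klDiv p (Measure.pi π) ≠ ∞) :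
    klDiv p (Measure.pi m) ≠ ∞ ∧ ∃ K : ℝ, ∀ q ∈ Couplings m, klDiv q (Measure.pi m) ≠ ∞ →
      klDiv q (Measure.pi π) ≠ ∞ ∧
        (klDiv q (Measure.pi π)).toReal = (klDiv q (Measure.pi m)).toReal + K := by
  have := hp.1
  obtain ⟨hpπ, hpi⟩ := klDiv_ne_top_iff.1 hfin
  -- Passing to a marginal does not increase the relative entropy.
  have hmi : ∀ i, klDiv (m i) (π i) ≠ ∞ := fun i => by
    refine ne_top_of_le_ne_top hfin ?_
    rw [← hp.2.2 i, ← (measurePreserving_eval π i).map_eq]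
    exact klDiv_map_le _ _ (measurable_pi_apply i)
  have hac : ∀ i, m i ≪ π i := fun i => (klDiv_ne_top_iff.1 (hmi i)).1
  have hint : ∀ i, Integrable (llr (m i) (π i)) (m i) := fun i => (klDiv_ne_top_iff.1 (hmi i)).2
  have hmπ : Measure.pi m ≪ Measure.pi π := absolutelyContinuous_pi hac
  have key : ∀ q ∈ Couplings m, llr q (Measure.pi π) =ᵐ[q]
      fun θ => llr q (Measure.pi m) θ + ∑ i, llr (m i) (π i) (θ i) := by
    intro q hq
    have := hq.1
    have hqm := absolutelyContinuous_pi_of_mem_couplings hq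
    filter_upwards [llr_ae_eq_add hqm hmπ, hqm (llr_pi hac)] with θ h1 h2
    rw [h1, h2]
  refine ⟨?_, ∑ i, ∫ t, llr (m i) (π i) t ∂(m i), fun q hq hqfin => ?_⟩
  · refine klDiv_ne_top (absolutelyContinuous_pi_of_mem_couplings hp) ?_
    refine (hpi.sub (integrable_sum_of_mem_couplings hp hint)).congr ?_
    filter_upwards [key p hp] with θ h
    simp [h]
  · have := hq.1
    obtain ⟨hqm, hqi⟩ := klDiv_ne_top_iff.1 hqfin
    have hs := integrable_sum_of_mem_couplings hq hint
    refine ⟨klDiv_ne_top (hqm.trans hmπ) ((hqi.add hs).congr (key q hq).symm), ?_⟩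
    rw [toReal_klDiv_of_measure_eq (hqm.trans hmπ) (by simp),
      toReal_klDiv_of_measure_eq hqm (by simp), integral_congr_ae (key q hq),
      integral_add hqi hs, integral_sum_of_mem_couplings hq hint]

end Products

/-! ### The Wasserstein distance -/

section Wasserstein

open scoped ProbabilityTheory

variable {D : ℕ}

theorem measurable_sqDist : Measurable fun p : (Fin D → ℝ) × (Fin D → ℝ) => sqDist p.1 p.2 := by
  unfold sqDist; fun_prop

theorem sqDist_comm (x y : Fin D → ℝ) : sqDist x y = sqDist y x :=
  Finset.sum_congr rfl fun _ _ => by ring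

theorem sqDist_eq_dist_sq (x y : Fin D → ℝ) :
    sqDist x y = dist (WithLp.toLp 2 x : EuclideanSpace ℝ (Fin D)) (WithLp.toLp 2 y) ^ 2 := by
  rw [EuclideanSpace.dist_eq, Real.sq_sqrt (Finset.sum_nonneg fun _ _ => sq_nonneg _)]
  simp [sqDist, Real.dist_eq, sq_abs]

/-- The Euclidean cost is the square of an extended distance, so that Minkowski's inequality applies
to the integrated cost. -/
theorem ofReal_sqDist (x y : Fin D → ℝ) :
    ENNReal.ofReal (sqDist x y)
      = edist (WithLp.toLp 2 x : EuclideanSpace ℝ (Fin D)) (WithLp.toLp 2 y) ^ (2 : ℝ) := by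
  rw [sqDist_eq_dist_sq, edist_dist, ENNReal.ofReal_pow dist_nonneg]
  norm_cast

theorem W2_le_of_coupling {μ ν : Measure (Fin D → ℝ)}
    {γ : Measure ((Fin D → ℝ) × (Fin D → ℝ))} (h1 : γ.map Prod.fst = μ) (h2 : γ.map Prod.snd = ν) :
    W2 μ ν ≤ (∫⁻ p, ENNReal.ofReal (sqDist p.1 p.2) ∂γ) ^ (1 / 2 : ℝ) :=
  ENNReal.rpow_le_rpow (iInf₂_le γ ⟨h1, h2⟩) (by norm_num)

theorem exists_coupling_of_W2_lt {μ ν : Measure (Fin D → ℝ)} {c : ℝ≥0∞} (h : W2 μ ν < c) :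
    ∃ γ : Measure ((Fin D → ℝ) × (Fin D → ℝ)), γ.map Prod.fst = μ ∧ γ.map Prod.snd = ν ∧
      (∫⁻ p, ENNReal.ofReal (sqDist p.1 p.2) ∂γ) ^ (1 / 2 : ℝ) < c := by
  have h' : (⨅ γ ∈ {γ : Measure ((Fin D → ℝ) × (Fin D → ℝ)) |
      γ.map Prod.fst = μ ∧ γ.map Prod.snd = ν},
      ∫⁻ p, ENNReal.ofReal (sqDist p.1 p.2) ∂γ) < c ^ (2 : ℝ) := by
    have := ENNReal.rpow_lt_rpow h (z := 2) (by norm_num)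
    rwa [W2, ← ENNReal.rpow_mul, one_div_mul_cancel (by norm_num), ENNReal.rpow_one] at this
  simp only [iInf_lt_iff] at h'
  obtain ⟨γ, ⟨h1, h2⟩, h3⟩ := h'
  refine ⟨γ, h1, h2, ?_⟩
  have := ENNReal.rpow_lt_rpow h3 (z := 1 / 2) (by norm_num)
  rwa [← ENNReal.rpow_mul, mul_one_div_cancel (by norm_num), ENNReal.rpow_one] at this

theorem lintegral_sqDist_map_swap (γ : Measure ((Fin D → ℝ) × (Fin D → ℝ))) :
    ∫⁻ p, ENNReal.ofReal (sqDist p.1 p.2) ∂(γ.map Prod.swap)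
      = ∫⁻ p, ENNReal.ofReal (sqDist p.1 p.2) ∂γ := by
  rw [lintegral_map measurable_sqDist.ennreal_ofReal measurable_swap]
  simp_rw [Prod.fst_swap, Prod.snd_swap, sqDist_comm]

theorem W2_comm_le (μ ν : Measure (Fin D → ℝ)) : W2 μ ν ≤ W2 ν μ := by
  refine le_of_forall_gt fun c hc => ?_
  obtain ⟨γ, h1, h2, h3⟩ := exists_coupling_of_W2_lt hc
  refine lt_of_le_of_lt (W2_le_of_coupling (γ := γ.map Prod.swap) ?_ ?_)
    (by rwa [lintegral_sqDist_map_swap])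
  · rw [Measure.map_map measurable_fst measurable_swap]; exact h2
  · rw [Measure.map_map measurable_snd measurable_swap]; exact h1

theorem W2_comm (μ ν : Measure (Fin D → ℝ)) : W2 μ ν = W2 ν μ :=
  le_antisymm (W2_comm_le μ ν) (W2_comm_le ν μ)

/-- Gluing: two couplings with a common marginal come from one law on triples, obtained by
drawing the third point from the conditional law given the second. -/
theorem exists_gluing {X : Type*} [MeasurableSpace X] [StandardBorelSpace X] [Nonempty X]
    {γ₁ γ₂ : Measure (X × X)} [IsProbabilityMeasure γ₁] [IsProbabilityMeasure γ₂]
    (h : γ₁.map Prod.snd = γ₂.map Prod.fst) :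
    ∃ Γ : Measure ((X × X) × X), Γ.map Prod.fst = γ₁ ∧ Γ.map (fun p => (p.1.2, p.2)) = γ₂ := by
  refine ⟨γ₁ ⊗ₘ (γ₂.condKernel.comap Prod.snd measurable_snd), ?_, ?_⟩
  · exact Measure.fst_compProd γ₁ _
  · refine Measure.ext_of_lintegral _ fun f hf => ?_
    rw [lintegral_map hf (by fun_prop), Measure.lintegral_compProd (by fun_prop)]
    conv_rhs => rw [← γ₂.disintegrate γ₂.condKernel]
    rw [Measure.lintegral_compProd hf, Measure.fst, ← h,
      lintegral_map (Measurable.lintegral_kernel_prod_right' hf) measurable_snd]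
    rfl

theorem W2_triangle {μ ν κ : Measure (Fin D → ℝ)} [hμ : IsProbabilityMeasure μ]
    [hκ : IsProbabilityMeasure κ] : W2 μ κ ≤ W2 μ ν + W2 ν κ := by
  refine le_of_forall_gt fun c hc => ?_
  obtain ⟨a, ha, b, hb, hab⟩ := ENNReal.exists_add_lt_of_add_lt hc
  obtain ⟨γ₁, h11, h12, h13⟩ := exists_coupling_of_W2_lt ha
  obtain ⟨γ₂, h21, h22, h23⟩ := exists_coupling_of_W2_lt hb
  have : IsProbabilityMeasure γ₁ := by
    rw [← h11] at hμ
    exact Measure.isProbabilityMeasure_of_map Prod.fst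
  have : IsProbabilityMeasure γ₂ := by
    rw [← h22] at hκ
    exact Measure.isProbabilityMeasure_of_map Prod.snd
  obtain ⟨Γ, hΓ1, hΓ2⟩ := exists_gluing (h12.trans h21.symm)
  refine lt_of_le_of_lt ?_ hab
  let e : (Fin D → ℝ) → (Fin D → ℝ) → ℝ≥0∞ := fun x y =>
    edist (WithLp.toLp 2 x : EuclideanSpace ℝ (Fin D)) (WithLp.toLp 2 y)
  have he : Measurable fun p : (Fin D → ℝ) × (Fin D → ℝ) => e p.1 p.2 := by
    have : Measurable (WithLp.toLp 2 : (Fin D → ℝ) → EuclideanSpace ℝ (Fin D)) :=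
      WithLp.measurable_toLp 2 _
    exact (this.comp measurable_fst).edist (this.comp measurable_snd)
  have hc1 : ∫⁻ p, ENNReal.ofReal (sqDist p.1 p.2) ∂γ₁ = ∫⁻ p, e p.1.1 p.1.2 ^ (2 : ℝ) ∂Γ := by
    rw [← hΓ1, lintegral_map measurable_sqDist.ennreal_ofReal measurable_fst]
    exact lintegral_congr fun p => ofReal_sqDist _ _
  have hc2 : ∫⁻ p, ENNReal.ofReal (sqDist p.1 p.2) ∂γ₂ = ∫⁻ p, e p.1.2 p.2 ^ (2 : ℝ) ∂Γ := by
    rw [← hΓ2, lintegral_map measurable_sqDist.ennreal_ofReal (by fun_prop)]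
    exact lintegral_congr fun p => ofReal_sqDist _ _
  have hm : Measurable fun p : ((Fin D → ℝ) × (Fin D → ℝ)) × (Fin D → ℝ) => (p.1.1, p.2) := by
    fun_prop
  have h1 : (Γ.map fun p => (p.1.1, p.2)).map Prod.fst = μ := by
    rw [Measure.map_map measurable_fst hm, ← h11, ← hΓ1,
      Measure.map_map measurable_fst measurable_fst]
    rfl
  have h2 : (Γ.map fun p => (p.1.1, p.2)).map Prod.snd = κ := by
    rw [Measure.map_map measurable_snd hm, ← h22, ← hΓ2,
      Measure.map_map measurable_snd (by fun_prop)]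
    rfl
  let e₁ : ((Fin D → ℝ) × (Fin D → ℝ)) × (Fin D → ℝ) → ℝ≥0∞ := fun p => e p.1.1 p.1.2
  let e₂ : ((Fin D → ℝ) × (Fin D → ℝ)) × (Fin D → ℝ) → ℝ≥0∞ := fun p => e p.1.2 p.2
  calc W2 μ κ ≤ (∫⁻ p, ENNReal.ofReal (sqDist p.1 p.2) ∂(Γ.map fun p => (p.1.1, p.2)))
        ^ (1 / 2 : ℝ) := W2_le_of_coupling h1 h2
    _ = (∫⁻ p, e p.1.1 p.2 ^ (2 : ℝ) ∂Γ) ^ (1 / 2 : ℝ) := by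
        rw [lintegral_map measurable_sqDist.ennreal_ofReal hm]
        simp_rw [ofReal_sqDist]; rfl
    _ ≤ (∫⁻ p, (e₁ + e₂) p ^ (2 : ℝ) ∂Γ) ^ (1 / 2 : ℝ) := by
        gcongr with p
        exact edist_triangle _ _ _
    _ ≤ (∫⁻ p, e p.1.1 p.1.2 ^ (2 : ℝ) ∂Γ) ^ (1 / 2 : ℝ)
        + (∫⁻ p, e p.1.2 p.2 ^ (2 : ℝ) ∂Γ) ^ (1 / 2 : ℝ) :=
        ENNReal.lintegral_Lp_add_le (f := e₁) (g := e₂) (he.comp measurable_fst).aemeasurable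
        (he.comp ((measurable_snd.comp measurable_fst).prodMk measurable_snd)).aemeasurable
        one_le_two
    _ ≤ a + b := by
        rw [← hc1, ← hc2]
        exact add_le_add h13.le h23.le

end Wasserstein

/-! ### Reweighting product measures -/

section Resampling

open Set

variable {D : ℕ} {X : Type*} [MeasurableSpace X]

theorem measurable_update_prod (i : Fin D) :
    Measurable fun p : (Fin D → X) × X => Function.update p.1 i p.2 := by
  refine measurable_pi_lambda _ fun j => ?_
  by_cases h : j = i
  · subst h; simpa using measurable_snd
  · simp only [Function.update_of_ne h]
    exact (measurable_pi_apply j).comp measurable_fst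

/-- Replacing one coordinate of a product law by an independent copy does not change the law. -/
theorem measurePreserving_update (γ : Fin D → Measure X) [∀ i, IsProbabilityMeasure (γ i)]
    (i : Fin D) : MeasurePreserving (fun p : (Fin D → X) × X => Function.update p.1 i p.2)
      ((Measure.pi γ).prod (γ i)) (Measure.pi γ) := by
  refine ⟨measurable_update_prod i, (Measure.pi_eq fun s hs => ?_).symm⟩
  rw [Measure.map_apply (measurable_update_prod i) (MeasurableSet.univ_pi hs)]
  have : (fun p : (Fin D → X) × X => Function.update p.1 i p.2) ⁻¹' univ.pi s
      = (univ.pi (Function.update s i univ)) ×ˢ s i := by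
    ext ⟨ω, t⟩
    simp only [mem_preimage, Set.mem_pi, mem_univ, true_implies, mem_prod]
    constructor
    · intro h
      refine ⟨fun j => ?_, by simpa using h i⟩
      by_cases hj : j = i
      · subst hj; simp
      · simpa [hj] using h j
    · rintro ⟨h, h'⟩ j
      by_cases hj : j = i
      · subst hj; simpa using h'
      · simpa [hj] using h j
  rw [this, Measure.prod_prod, Measure.pi_pi]
  rw [← Finset.mul_prod_erase _ _ (Finset.mem_univ i),
    ← Finset.mul_prod_erase _ (fun j => γ j (s j)) (Finset.mem_univ i)]
  rw [Function.update_self, measure_univ, one_mul, mul_comm]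
  congr 1
  refine Finset.prod_congr rfl fun j hj => ?_
  rw [Function.update_of_ne (Finset.ne_of_mem_erase hj)]

/-- The marginals of a reweighted product measure. -/
theorem map_eval_withDensity_pi (γ : Fin D → Measure X) [∀ i, IsProbabilityMeasure (γ i)]
    {g : (Fin D → X) → ℝ≥0∞} (hg : Measurable g) (i : Fin D) :
    ((Measure.pi γ).withDensity g).map (fun ω => ω i)
      = (γ i).withDensity fun t => ∫⁻ ω, g (Function.update ω i t) ∂(Measure.pi γ) := by
  refine Measure.ext_of_lintegral _ fun f hf => ?_
  have hgu := hg.comp (measurable_update_prod (X := X) i)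
  have hG : Measurable fun t => ∫⁻ ω, g (Function.update ω i t) ∂(Measure.pi γ) :=
    hgu.lintegral_prod_left'
  have hfi : Measurable fun ω : Fin D → X => f (ω i) := hf.comp (measurable_pi_apply i)
  rw [lintegral_map hf (measurable_pi_apply i), lintegral_withDensity_eq_lintegral_mul _ hg hfi,
    ← (measurePreserving_update γ i).lintegral_comp (hg.mul hfi),
    lintegral_prod_symm' (fun p : (Fin D → X) × X =>
      (g * fun ω : Fin D → X => f (ω i)) (Function.update p.1 i p.2))
      ((hg.mul hfi).comp (measurable_update_prod i)),
    lintegral_withDensity_eq_lintegral_mul _ hG hf]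
  refine lintegral_congr fun t => ?_
  simp only [Pi.mul_apply, Function.update_self]
  exact lintegral_mul_const _ (hgu.comp (measurable_id.prodMk measurable_const))

end Resampling

/-! ### Shadows of couplings -/

section Shadow

variable {D : ℕ}

theorem map_withDensity_comp {α β : Type*} {mα : MeasurableSpace α} {mβ : MeasurableSpace β}
    {f : α → β} (hf : Measurable f) (ρ : Measure α) {g : β → ℝ≥0∞} (hg : Measurable g) :
    (ρ.withDensity (g ∘ f)).map f = (ρ.map f).withDensity g := by
  ext s hs
  rw [Measure.map_apply hf hs, withDensity_apply _ (hf hs), withDensity_apply _ hs,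
    setLIntegral_map hs hg hf]
  rfl

/-- If reweighting a product measure by `g` preserves the `i`-th marginal, then `g` integrates to one
over almost every slice on which the `i`-th coordinate is fixed. -/
theorem lintegral_update_ae_eq_one {X : Type*} [MeasurableSpace X] {m : Fin D → Measure X}
    [∀ i, IsProbabilityMeasure (m i)] {g : (Fin D → X) → ℝ≥0∞} (hg : Measurable g) (i : Fin D)
    (h : ((Measure.pi m).withDensity g).map (fun ω => ω i) = m i) :
    (fun t => ∫⁻ y, g (Function.update y i t) ∂(Measure.pi m)) =ᵐ[m i] 1 := by
  rw [map_eval_withDensity_pi m hg i] at h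
  have hm : Measurable fun t => ∫⁻ y, g (Function.update y i t) ∂(Measure.pi m) :=
    (hg.comp (measurable_update_prod i)).lintegral_prod_left'
  refine (withDensity_eq_iff_of_sigmaFinite hm.aemeasurable aemeasurable_one).1 ?_
  exact h.trans withDensity_one.symm

theorem ofReal_sqDist_eq_sum (x y : Fin D → ℝ) :
    ENNReal.ofReal (sqDist x y) = ∑ i, ENNReal.ofReal ((x i - y i) ^ 2) :=
  ENNReal.ofReal_sum_of_nonneg fun _ _ => sq_nonneg _

/-- The shadow of a coupling `q'` of `m'` on the marginals `m`: transporting each coordinate of `q'`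
by the conditional law of `x_i` given `y_i` under `γ` gives a coupling of `m` that is as close to
`q'` as the cost of `γ`, and whose relative entropy is not larger. It is realized by reweighting
the law of independent pairs `(x_i, y_i)` with the density of `q'` in the variables `y_i`. -/
theorem exists_shadow {m m' : Fin D → Measure ℝ} [∀ i, IsProbabilityMeasure (m i)]
    [∀ i, IsProbabilityMeasure (m' i)] (hm : ∀ i, m i ≪ volume)
    {γ : Measure ((Fin D → ℝ) × (Fin D → ℝ))} (h1 : γ.map Prod.fst = Measure.pi m)
    (h2 : γ.map Prod.snd = Measure.pi m') {q' : Measure (Fin D → ℝ)} (hq' : q' ∈ Couplings m') :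
    ∃ q ∈ Couplings m, W2 q q' ≤ (∫⁻ p, ENNReal.ofReal (sqDist p.1 p.2) ∂γ) ^ (1 / 2 : ℝ) ∧
      klDiv q (Measure.pi m) ≤ klDiv q' (Measure.pi m') := by
  have := hq'.1
  have hγp : IsProbabilityMeasure γ := by
    have : IsProbabilityMeasure (γ.map Prod.fst) := by rw [h1]; infer_instance
    exact Measure.isProbabilityMeasure_of_map Prod.fst
  have hpair : ∀ i, Measurable fun p : (Fin D → ℝ) × (Fin D → ℝ) => (p.1 i, p.2 i) :=
    fun i => by fun_prop
  set γi : Fin D → Measure (ℝ × ℝ) := fun i => γ.map fun p => (p.1 i, p.2 i) with hγi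
  have : ∀ i, IsProbabilityMeasure (γi i) := fun i =>
    Measure.isProbabilityMeasure_map (hpair i).aemeasurable
  have hfst : ∀ i, (γi i).map Prod.fst = m i := fun i => by
    rw [← (measurePreserving_eval m i).map_eq, ← h1, Measure.map_map measurable_fst (hpair i),
      Measure.map_map (measurable_pi_apply i) measurable_fst]
    rfl
  have hsnd : ∀ i, (γi i).map Prod.snd = m' i := fun i => by
    rw [← (measurePreserving_eval m' i).map_eq, ← h2, Measure.map_map measurable_snd (hpair i),
      Measure.map_map (measurable_pi_apply i) measurable_snd]
    rfl
  set Γ : Measure (Fin D → ℝ × ℝ) := Measure.pi γi with hΓ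
  let f₁ : (Fin D → ℝ × ℝ) → Fin D → ℝ := fun ω i => (ω i).1
  let f₂ : (Fin D → ℝ × ℝ) → Fin D → ℝ := fun ω i => (ω i).2
  have hf₁ : Measurable f₁ := by fun_prop
  have hf₂ : Measurable f₂ := by fun_prop
  have hΓ₁ : Γ.map f₁ = Measure.pi m := (measurePreserving_pi γi m fun i =>
    ⟨measurable_fst, hfst i⟩).map_eq
  have hΓ₂ : Γ.map f₂ = Measure.pi m' := (measurePreserving_pi γi m' fun i =>
    ⟨measurable_snd, hsnd i⟩).map_eq
  set g := q'.rnDeriv (Measure.pi m') with hg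
  have hgm : Measurable g := Measure.measurable_rnDeriv _ _
  have hgq : (Measure.pi m').withDensity g = q' :=
    Measure.withDensity_rnDeriv_eq _ _ (absolutelyContinuous_pi_of_mem_couplings hq')
  set ρ := Γ.withDensity (g ∘ f₂) with hρ
  have hρ₂ : ρ.map f₂ = q' := by rw [hρ, map_withDensity_comp hf₂ _ hgm, hΓ₂, hgq]
  have hρp : IsProbabilityMeasure ρ := by
    have : IsProbabilityMeasure (ρ.map f₂) := by rwa [hρ₂]
    exact Measure.isProbabilityMeasure_of_map f₂
  -- Since `q'` has the marginals `m'`, the reweighting does not change the law of `(x_i, y_i)`.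
  have hρi : ∀ i, ρ.map (fun ω => ω i) = γi i := by
    intro i
    have hone := lintegral_update_ae_eq_one hgm i (by rw [hgq]; exact hq'.2.2 i)
    rw [hρ, hΓ, map_eval_withDensity_pi γi (hgm.comp hf₂) i]
    rw [← hsnd i] at hone
    have hone' := ae_of_ae_map measurable_snd.aemeasurable hone
    conv_rhs => rw [← withDensity_one (μ := γi i)]
    refine withDensity_congr_ae ?_
    filter_upwards [hone'] with t ht
    refine Eq.trans ?_ ht
    have hgt : Measurable fun y : Fin D → ℝ => g (Function.update y i t.2) :=
      hgm.comp ((measurable_update_prod i).comp (measurable_id.prodMk measurable_const))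
    rw [← hΓ₂, lintegral_map hgt hf₂]
    refine lintegral_congr fun ω => ?_
    simp only [Function.comp]
    congr 1
    ext j
    by_cases hj : j = i
    · subst hj; simp [f₂]
    · simp [f₂, hj]
  refine ⟨ρ.map f₁, ⟨?_, ?_, fun i => ?_⟩, ?_, ?_⟩
  · exact Measure.isProbabilityMeasure_map hf₁.aemeasurable
  · refine ((withDensity_absolutelyContinuous _ _).map hf₁).trans ?_
    rw [hΓ₁]
    exact absolutelyContinuous_pi hm
  · rw [marginal, Measure.map_map (measurable_pi_apply i) hf₁, ← hfst i, ← hρi i,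
      Measure.map_map measurable_fst (measurable_pi_apply i)]
    rfl
  · have hf : Measurable fun ω => (f₁ ω, f₂ ω) := hf₁.prodMk hf₂
    refine (W2_le_of_coupling (γ := ρ.map fun ω => (f₁ ω, f₂ ω)) ?_ ?_).trans (le_of_eq ?_)
    · rw [Measure.map_map measurable_fst hf]; rfl
    · rw [Measure.map_map measurable_snd hf]; exact hρ₂
    · congr 1
      have hc : Measurable fun p : ℝ × ℝ => ENNReal.ofReal ((p.1 - p.2) ^ 2) := by fun_prop
      rw [lintegral_map measurable_sqDist.ennreal_ofReal hf]
      simp_rw [ofReal_sqDist_eq_sum]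
      rw [lintegral_finsetSum _ fun i _ => by fun_prop,
        lintegral_finsetSum _ fun i _ => by fun_prop]
      refine Finset.sum_congr rfl fun i _ => ?_
      have h := lintegral_map (μ := ρ) hc (measurable_pi_apply i)
      rw [hρi i, lintegral_map hc (hpair i)] at h
      exact h.symm
  · have : IsFiniteMeasure ((Γ.map f₂).withDensity g) := by rw [hΓ₂, hgq]; infer_instance
    have hk : klDiv ρ Γ = klDiv q' (Measure.pi m') := by
      rw [hρ, klDiv_withDensity_comp hf₂ hgm, hΓ₂, hgq]
    rw [← hk, ← hΓ₁]
    exact klDiv_map_le _ _ hf₁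

end Shadow

/-! ### The objectives and the one-step correction -/

section Objectives

variable {D : ℕ}

theorem penalizedLoss_ne_top {ℓ : (Fin D → ℝ) → ℝ} {R : ℝ≥0∞} {q : Measure (Fin D → ℝ)}
    (h : penalizedLoss ℓ R q ≠ ⊤) : Integrable ℓ q ∧ R ≠ ∞ := by
  unfold penalizedLoss at h
  split_ifs at h with hi
  · refine ⟨hi, ?_⟩
    rintro rfl
    simp at h
  · exact absurd rfl h

theorem penalizedLoss_eq_coe {ℓ : (Fin D → ℝ) → ℝ} {R : ℝ≥0∞} {q : Measure (Fin D → ℝ)}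
    (hi : Integrable ℓ q) (hR : R ≠ ∞) :
    penalizedLoss ℓ R q = ((-(∫ θ, ℓ θ ∂q) + R.toReal : ℝ) : EReal) := by
  lift R to ℝ≥0 using hR
  rw [penalizedLoss, if_pos hi, integral_neg]
  rfl

theorem sinkhornKernel_eq (ℓ : (Fin D → ℝ) → ℝ) (lam : ℝ≥0) (φ : Fin D → ℝ → ℝ) (i : Fin D)
    (t : ℝ) (y : Fin D → ℝ) :
    Real.exp ((∑ j, φ j (Function.update y i t j)) + ℓ (Function.update y i t) / (lam + 1))
      = Real.exp (φ i t) * sinkhornKernel ℓ lam φ i t y := by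
  rw [sinkhornKernel, ← Real.exp_add, ← Finset.add_sum_erase _ _ (Finset.mem_univ i),
    Function.update_self, add_assoc]
  congr 3
  refine Finset.sum_congr rfl fun j hj => ?_
  rw [Function.update_of_ne (Finset.ne_of_mem_erase hj)]

/-- At a fixed point of the Sinkhorn updates, each marginal of the reweighted product measure is
a constant multiple of the prescribed one. The constants all equal the total mass, which is one
because the last update carries no centring constant. -/
theorem mem_couplings_of_isSinkhornPotential (hD : 0 < D) {ℓ : (Fin D → ℝ) → ℝ}
    (hℓ : Measurable ℓ) {lam : ℝ≥0} {m : Fin D → Measure ℝ} [∀ i, IsProbabilityMeasure (m i)]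
    (hm : ∀ i, m i ≪ volume) {φ : Fin D → ℝ → ℝ} (hφ : IsSinkhornPotential ℓ lam m φ) :
    (Measure.pi m).withDensity
      (fun θ => ENNReal.ofReal (Real.exp ((∑ i, φ i (θ i)) + ℓ θ / (lam + 1)))) ∈ Couplings m := by
  have hφm := hφ.measurable
  set g : (Fin D → ℝ) → ℝ≥0∞ :=
    fun θ => ENNReal.ofReal (Real.exp ((∑ i, φ i (θ i)) + ℓ θ / (lam + 1))) with hg
  have hgm : Measurable g := by fun_prop
  set q := (Measure.pi m).withDensity g with hq
  set η : Fin D → ℝ := fun i =>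
    if (i : ℕ) + 1 < D then ∫ s, sinkhornLog ℓ lam m φ i s ∂(m i) else 0 with hη
  have hmarg : ∀ i, marginal q i = ENNReal.ofReal (Real.exp (η i)) • m i := by
    intro i
    rw [marginal, hq, map_eval_withDensity_pi m hgm i, ← withDensity_const]
    refine withDensity_congr_ae ?_
    filter_upwards [hφ.kernel_integrable i, hφ.fixed i] with t hk hf
    have hpos : 0 < ∫ y, sinkhornKernel ℓ lam φ i t y ∂(Measure.pi m) := integral_exp_pos hk
    have hZ : ∫ y, sinkhornKernel ℓ lam φ i t y ∂(Measure.pi m)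
        = Real.exp (sinkhornLog ℓ lam m φ i t) := (Real.exp_log hpos).symm
    simp_rw [hg, sinkhornKernel_eq, ENNReal.ofReal_mul (Real.exp_nonneg _)]
    rw [lintegral_const_mul' _ _ ENNReal.ofReal_ne_top,
      ← ofReal_integral_eq_lintegral_ofReal hk (ae_of_all _ fun _ => Real.exp_nonneg _), hZ,
      ← ENNReal.ofReal_mul (Real.exp_nonneg _), ← Real.exp_add]
    congr 2
    rw [hf, sinkhornUpdate]
    simp only [hη]
    ring
  have hmass : ∀ i, q Set.univ = ENNReal.ofReal (Real.exp (η i)) := by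
    intro i
    have h := congrArg (fun μ : Measure ℝ => μ Set.univ) (hmarg i)
    simpa [marginal, Measure.map_apply (measurable_pi_apply i)] using h
  have hone : q Set.univ = 1 := by
    rw [hmass ⟨D - 1, by omega⟩]
    have : η ⟨D - 1, by omega⟩ = 0 := if_neg (by simp only; omega)
    simp [this]
  refine ⟨⟨hone⟩, ?_, fun i => ?_⟩
  · exact (withDensity_absolutelyContinuous _ _).trans (absolutelyContinuous_pi hm)
  · rw [hmarg i, ← hmass i, hone, one_smul]

/-- The one-step correction solves the entropic optimal transport problem: its log-density is the
sum of `ℓ / (lam + 1)` and of functions of single coordinates, whose expectation is the same for all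
couplings, so that the claim is the Gibbs variational principle. -/
theorem IsOneStepOutput.isEOTOptimizer (hD : 0 < D) {ℓ : (Fin D → ℝ) → ℝ}
    (hℓ : Measurable ℓ) {lam : ℝ≥0} {m : Fin D → Measure ℝ} [∀ i, IsProbabilityMeasure (m i)]
    (hm : ∀ i, m i ≪ volume) (hint : ∀ q ∈ Couplings m, Integrable ℓ q)
    {q : Measure (Fin D → ℝ)} (hq : IsOneStepOutput ℓ lam m q) : IsEOTOptimizer ℓ lam m q := by
  obtain ⟨φ, hφ, hqdef⟩ := hq
  have hqC : q ∈ Couplings m := hqdef ▸ mem_couplings_of_isSinkhornPotential hD hℓ hm hφ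
  have := hqC.1
  have hφm := hφ.measurable
  have hl : (0 : ℝ) < lam + 1 := by positivity
  have hF : Measurable fun θ : Fin D → ℝ => (∑ i, φ i (θ i)) + ℓ θ / (lam + 1) := by fun_prop
  have hqm := absolutelyContinuous_pi_of_mem_couplings hqC
  have hmq : Measure.pi m ≪ q := by
    rw [hqdef]
    refine withDensity_absolutelyContinuous' (by fun_prop) (ae_of_all _ fun θ => ?_)
    exact (ENNReal.ofReal_pos.2 (Real.exp_pos _)).ne'
  have hllr : llr q (Measure.pi m) =ᵐ[Measure.pi m]
      fun θ => (∑ i, φ i (θ i)) + ℓ θ / (lam + 1) := by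
    rw [hqdef]; exact llr_withDensity_ofReal_exp hF
  have hFi : ∀ p ∈ Couplings m, Integrable (llr q (Measure.pi m)) p ∧
      ∫ θ, llr q (Measure.pi m) θ ∂p
        = (∑ i, ∫ t, φ i t ∂(m i)) + (∫ θ, ℓ θ ∂p) / (lam + 1) := by
    intro p hp
    have he := (absolutelyContinuous_pi_of_mem_couplings hp).ae_eq hllr
    have h1 := integrable_sum_of_mem_couplings hp hφ.integrable
    have h2 := (hint p hp).div_const (lam + 1 : ℝ)
    refine ⟨(h1.add h2).congr he.symm, ?_⟩
    rw [integral_congr_ae he, integral_add h1 h2,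
      integral_sum_of_mem_couplings hp hφ.integrable, integral_div]
  have hne : ((lam : ℝ≥0∞) + 1) ≠ ∞ := by finiteness
  have hfin : klDiv q (Measure.pi m) ≠ ∞ := klDiv_ne_top hqm (hFi q hqC).1
  have hobj := penalizedLoss_eq_coe (hint q hqC) (ENNReal.mul_ne_top hne hfin)
  refine ⟨hqC, ?_, fun p hp => ?_⟩
  · rw [eotObjective, hobj]; exact EReal.coe_ne_top _
  · have := hp.1
    by_cases hpt : penalizedLoss ℓ ((lam + 1) * klDiv p (Measure.pi m)) p = ⊤
    · rw [eotObjective, eotObjective, hpt]; exact le_top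
    have hR := (penalizedLoss_ne_top hpt).2
    have hpk : klDiv p (Measure.pi m) ≠ ∞ := by
      intro h
      rw [h, ENNReal.mul_top (by simp)] at hR
      exact hR rfl
    rw [eotObjective, eotObjective, hobj, penalizedLoss_eq_coe (hint p hp) hR,
      EReal.coe_le_coe_iff, ENNReal.toReal_mul, ENNReal.toReal_mul,
      toReal_klDiv_of_measure_eq hqm (by simp), (hFi q hqC).2]
    have hg := integral_llr_le_toReal_klDiv hmq hqm hpk (hFi p hp).1
    rw [(hFi p hp).2] at hg
    have hL : ((lam : ℝ≥0∞) + 1).toReal = lam + 1 := by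
      rw [ENNReal.toReal_add (by simp) (by simp)]; simp
    rw [hL, mul_add, mul_div_cancel₀ _ hl.ne']
    have := mul_le_mul_of_nonneg_left hg hl.le
    rw [mul_add, mul_div_cancel₀ _ hl.ne'] at this
    linarith

theorem IsEOTOptimizer.klDiv_ne_top {ℓ : (Fin D → ℝ) → ℝ} {lam : ℝ≥0} {m : Fin D → Measure ℝ}
    {q : Measure (Fin D → ℝ)} (hq : IsEOTOptimizer ℓ lam m q) : klDiv q (Measure.pi m) ≠ ∞ := by
  intro h
  have := (penalizedLoss_ne_top hq.2.1).2
  rw [h, ENNReal.mul_top (by simp)] at this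
  exact this rfl

theorem IsEOTOptimizer.real_le {ℓ : (Fin D → ℝ) → ℝ} {lam : ℝ≥0} {m : Fin D → Measure ℝ}
    {q : Measure (Fin D → ℝ)} (hq : IsEOTOptimizer ℓ lam m q) {p : Measure (Fin D → ℝ)}
    (hp : p ∈ Couplings m) (hℓp : Integrable ℓ p) (hpk : klDiv p (Measure.pi m) ≠ ∞) :
    -(∫ θ, ℓ θ ∂q) + (lam + 1) * (klDiv q (Measure.pi m)).toReal
      ≤ -(∫ θ, ℓ θ ∂p) + (lam + 1) * (klDiv p (Measure.pi m)).toReal := by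
  have hne : ((lam : ℝ≥0∞) + 1) ≠ ∞ := by finiteness
  have h := hq.2.2 p hp
  rw [eotObjective, eotObjective, penalizedLoss_eq_coe (penalizedLoss_ne_top hq.2.1).1
    (ENNReal.mul_ne_top hne hq.klDiv_ne_top), penalizedLoss_eq_coe hℓp
    (ENNReal.mul_ne_top hne hpk), EReal.coe_le_coe_iff, ENNReal.toReal_mul,
    ENNReal.toReal_mul] at h
  have hL : ((lam : ℝ≥0∞) + 1).toReal = lam + 1 := by
    rw [ENNReal.toReal_add (by simp) (by simp)]; simp
  rwa [hL] at h

end Objectives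

/-! ### Variational posteriors -/

section Posterior

variable {D : ℕ}

theorem marginal_of_mem_couplings {m : Fin D → Measure ℝ} {q : Measure (Fin D → ℝ)}
    (hq : q ∈ Couplings m) : marginal q = m := funext hq.2.2

theorem mem_couplings_marginal {Θ : Set (Fin D → ℝ)} {q : Measure (Fin D → ℝ)}
    (hq : q ∈ Dist2 Θ) : q ∈ Couplings (marginal q) :=
  ⟨hq.1.1, hq.1.2.1, fun _ => rfl⟩

theorem lintegral_sqDist_zero_of_mem_couplings {m : Fin D → Measure ℝ}
    {q : Measure (Fin D → ℝ)} (hq : q ∈ Couplings m) :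
    ∫⁻ θ, ENNReal.ofReal (sqDist θ 0) ∂q = ∑ i, ∫⁻ t, ENNReal.ofReal (t ^ 2) ∂(m i) := by
  simp_rw [ofReal_sqDist_eq_sum]
  rw [lintegral_finsetSum _ fun i _ => by fun_prop]
  refine Finset.sum_congr rfl fun i _ => ?_
  simp only [Pi.zero_apply, sub_zero]
  exact (measurePreserving_eval_of_mem_couplings hq i).lintegral_comp
    (f := fun t => ENNReal.ofReal (t ^ 2)) (by fun_prop)

/-- Membership in `𝒫₂(Θ)` depends only on the marginals, because `Θ` is a product. -/
theorem mem_dist2_of_mem_couplings {Θ : Fin D → Set ℝ} (hΘ : ∀ i, MeasurableSet (Θ i))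
    {p q : Measure (Fin D → ℝ)} (hp : p ∈ Dist2 (Set.univ.pi Θ))
    (hq : q ∈ Couplings (marginal p)) : q ∈ Dist2 (Set.univ.pi Θ) := by
  refine ⟨⟨hq.1, hq.2.1, ?_⟩, ?_⟩
  · have : (Set.univ.pi Θ)ᶜ = ⋃ i, (fun θ : Fin D → ℝ => θ i) ⁻¹' (Θ i)ᶜ := by
      ext θ; simp [Set.mem_pi]
    have hp0 := hp.1.2.2
    rw [this, measure_iUnion_null_iff] at hp0 ⊢
    intro i
    rw [← Measure.map_apply (measurable_pi_apply i) (hΘ i).compl]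
    have hi : q.map (fun θ => θ i) = p.map (fun θ => θ i) := hq.2.2 i
    rw [hi, Measure.map_apply (measurable_pi_apply i) (hΘ i).compl]
    exact hp0 i
  · rw [lintegral_sqDist_zero_of_mem_couplings hq,
      ← lintegral_sqDist_zero_of_mem_couplings (mem_couplings_marginal hp)]
    exact hp.2

/-- Among the couplings of its own marginals `m`, a variational posterior minimizes an entropic
optimal transport objective. Testing against the midpoint `h` with another coupling `s` and using
strict convexity of the relative entropy bounds the distance to `h` by the excess of the objective
at `s`. -/
theorem IsXiPosterior.klDiv_midpoint_le {Θ : Fin D → Set ℝ} (hΘ : ∀ i, MeasurableSet (Θ i))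
    {ℓ : (Fin D → ℝ) → ℝ} {prior : Fin D → Measure ℝ} [∀ i, IsProbabilityMeasure (prior i)]
    {lam : ℝ≥0} {p : Measure (Fin D → ℝ)}
    (hp : IsXiPosterior (Set.univ.pi Θ) ℓ (Measure.pi prior) lam p)
    (hint : ∀ q ∈ Couplings (marginal p), Integrable ℓ q) :
    klDiv p (Measure.pi (marginal p)) ≠ ∞ ∧
    ∀ s ∈ Couplings (marginal p), klDiv s (Measure.pi (marginal p)) ≠ ∞ →
      (lam + 1) * ((klDiv p (midpointMeasure p s)).toReal
          + (klDiv s (midpointMeasure p s)).toReal)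
        ≤ (-(∫ θ, ℓ θ ∂s) + (lam + 1) * (klDiv s (Measure.pi (marginal p))).toReal)
          - (-(∫ θ, ℓ θ ∂p) + (lam + 1) * (klDiv p (Measure.pi (marginal p))).toReal) := by
  have hpC := mem_couplings_marginal hp.1
  have := isProbabilityMeasure_of_mem_couplings hpC
  have := hpC.1
  have hR := (penalizedLoss_ne_top hp.2.1).2
  obtain ⟨hpfin, K, hK⟩ := exists_toReal_klDiv_pi_eq_add hpC (ENNReal.add_ne_top.1 hR).1
  refine ⟨hpfin, fun s hs hsfin => ?_⟩
  have := hs.1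
  have hobj : ∀ q ∈ Couplings (marginal p), klDiv q (Measure.pi (marginal p)) ≠ ∞ →
      xiObjective ℓ (Measure.pi prior) lam q = ((-(∫ θ, ℓ θ ∂q)
        + ((lam + 1) * (klDiv q (Measure.pi (marginal p))).toReal + K) : ℝ) : EReal) := by
    intro q hq hqfin
    obtain ⟨h1, h2⟩ := hK q hq hqfin
    have h3 : (lam : ℝ≥0∞) * klDiv q (Measure.pi (marginal p)) ≠ ∞ :=
      ENNReal.mul_ne_top ENNReal.coe_ne_top hqfin
    rw [xiObjective, expressivity, marginal_of_mem_couplings hq,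
      penalizedLoss_eq_coe (hint q hq) (ENNReal.add_ne_top.2 ⟨h1, h3⟩),
      ENNReal.toReal_add h1 h3, h2, ENNReal.toReal_mul, ENNReal.coe_toReal]
    congr 2
    ring
  have hh := midpointMeasure_mem_couplings hpC hs
  obtain ⟨hhfin, hid⟩ := two_mul_klDiv_midpointMeasure hpfin hsfin
  have hmin := hp.2.2 _ (mem_dist2_of_mem_couplings hΘ hp.1 hh)
  rw [hobj p hpC hpfin, hobj _ hh hhfin, EReal.coe_le_coe_iff] at hmin
  have hl := two_mul_integral_midpointMeasure (hint p hpC) (hint s hs)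
  linear_combination 2 * hmin - hl + (lam + 1 : ℝ) * hid

end Posterior

/-! ### Stability -/

section Stability

variable {D : ℕ}

/-- The functions of single coordinates in the Lipschitz condition contribute only a constant to
differences of expected log-likelihoods. -/
theorem LipschitzCost.exists_const {ℓ : (Fin D → ℝ) → ℝ} {L : ℝ≥0} {m m' : Fin D → Measure ℝ}
    (h : LipschitzCost ℓ L m m') :
    ∃ c : ℝ, ∀ q ∈ Couplings m, ∀ q' ∈ Couplings m', Integrable ℓ q ∧ Integrable ℓ q' ∧
      ENNReal.ofReal |(∫ θ, ℓ θ ∂q) - (∫ θ, ℓ θ ∂q') - c| ≤ L * W2 q q' := by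
  obtain ⟨φ, hφ, hL⟩ := h
  refine ⟨(∑ i, ∫ t, φ i t ∂(m i)) - ∑ i, ∫ t, φ i t ∂(m' i), fun q hq q' hq' => ?_⟩
  obtain ⟨h1, h2, h3⟩ := hL q hq q' hq'
  have hs := integrable_sum_of_mem_couplings hq fun i => (hφ i).2.1
  have hs' := integrable_sum_of_mem_couplings hq' fun i => (hφ i).2.2
  have hi : Integrable ℓ q := (h1.add hs).congr (ae_of_all _ fun θ => by simp)
  have hi' : Integrable ℓ q' := (h2.add hs').congr (ae_of_all _ fun θ => by simp)
  refine ⟨hi, hi', ?_⟩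
  rw [integral_sub hi hs, integral_sub hi' hs', integral_sum_of_mem_couplings hq fun i => (hφ i).2.1,
    integral_sum_of_mem_couplings hq' fun i => (hφ i).2.2] at h3
  convert! h3 using 3
  ring

theorem rpow_quarter_add_le {a b x : ℝ≥0∞} (h : a + b ≤ 2 * x) :
    a ^ (1 / 4 : ℝ) + b ^ (1 / 4 : ℝ) ≤ 2 * x ^ (1 / 4 : ℝ) := by
  rw [← ENNReal.rpow_le_rpow_iff (z := 4) (by norm_num)]
  refine (ENNReal.rpow_add_le_mul_rpow_add_rpow _ _ (by norm_num)).trans ?_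
  rw [ENNReal.mul_rpow_of_nonneg _ _ (by norm_num), ← ENNReal.rpow_mul, ← ENNReal.rpow_mul,
    ← ENNReal.rpow_mul, one_div_mul_cancel (by norm_num), ENNReal.rpow_one, ENNReal.rpow_one,
    ENNReal.rpow_one]
  calc (2 : ℝ≥0∞) ^ ((4 : ℝ) - 1) * (a + b) ≤ 2 ^ ((4 : ℝ) - 1) * (2 * x) := by gcongr
    _ = 2 ^ (4 : ℝ) * x := by
        rw [← mul_assoc]
        congr 1
        rw [show (4 : ℝ) - 1 = (3 : ℕ) by norm_num, show (4 : ℝ) = (4 : ℕ) by norm_num,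
          ENNReal.rpow_natCast, ENNReal.rpow_natCast]
        norm_num

/-- The stability estimate for a fixed coupling `γ` of the two product measures, in terms of the
square root `δ` of its cost. The posterior `p` and the optimizer `q` are compared through the
shadow `s` of `q` on the marginals of `p` and the shadow of `p` on `m'`: the two optimality properties
show that the objective at `s` exceeds the minimum by at most `2 L δ`. -/
theorem W2_posterior_le_of_coupling {Θ : Fin D → Set ℝ} (hΘ : ∀ i, MeasurableSet (Θ i))
    {ℓ : (Fin D → ℝ) → ℝ} {prior : Fin D → Measure ℝ} [∀ i, IsProbabilityMeasure (prior i)]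
    {lam L C : ℝ≥0} {p : Measure (Fin D → ℝ)}
    (hp : IsXiPosterior (Set.univ.pi Θ) ℓ (Measure.pi prior) lam p)
    {m' : Fin D → Measure ℝ} [∀ i, IsProbabilityMeasure (m' i)] (hm' : ∀ i, m' i ≪ volume)
    (hLip : LipschitzCost ℓ L (marginal p) m') (hTrans : TransportCost C (marginal p))
    {q : Measure (Fin D → ℝ)} (hq : IsEOTOptimizer ℓ lam m' q)
    {γ : Measure ((Fin D → ℝ) × (Fin D → ℝ))}
    (h1 : γ.map Prod.fst = Measure.pi (marginal p)) (h2 : γ.map Prod.snd = Measure.pi m')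
    {δ : ℝ≥0∞} (hδ : δ = (∫⁻ x, ENNReal.ofReal (sqDist x.1 x.2) ∂γ) ^ (1 / 2 : ℝ))
    (hδt : δ ≠ ∞) :
    W2 p q ≤ δ + 2 * C * (L : ℝ≥0∞) ^ (1 / 4 : ℝ) * δ ^ (1 / 4 : ℝ) := by
  have hpC := mem_couplings_marginal hp.1
  have := isProbabilityMeasure_of_mem_couplings hpC
  have := hpC.1
  have := hq.1.1
  have hmac : ∀ i, marginal p i ≪ volume := fun i => by
    have h : p ≪ Measure.pi fun _ : Fin D => (volume : Measure ℝ) := hpC.2.1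
    exact (h.map (measurable_pi_apply i)).trans
      (Measure.quasiMeasurePreserving_eval (fun _ : Fin D => (volume : Measure ℝ)) i).2
  obtain ⟨c, hc⟩ := hLip.exists_const
  obtain ⟨s, hs, hsW, hsk⟩ := exists_shadow hmac h1 h2 hq.1
  obtain ⟨s', hs', hsW', hsk'⟩ := exists_shadow hm' (γ := γ.map Prod.swap)
    (by rw [Measure.map_map measurable_fst measurable_swap]; exact h2)
    (by rw [Measure.map_map measurable_snd measurable_swap]; exact h1) hpC
  rw [lintegral_sqDist_map_swap, W2_comm, ← hδ] at hsW'
  rw [← hδ] at hsW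
  have := hs.1
  obtain ⟨hpfin, hmid⟩ := hp.klDiv_midpoint_le hΘ fun r hr => (hc r hr q hq.1).1
  have hsfin := ne_top_of_le_ne_top hq.klDiv_ne_top hsk
  have hsfin' := ne_top_of_le_ne_top hpfin hsk'
  have e1 := hmid s hs hsfin
  have e2 := hq.real_le hs' (hc p hpC s' hs').2.1 hsfin'
  have hreal : ∀ r ∈ Couplings (marginal p), ∀ r' ∈ Couplings m', W2 r r' ≤ δ →
      |(∫ θ, ℓ θ ∂r) - (∫ θ, ℓ θ ∂r') - c| ≤ L * δ.toReal := by
    intro r hr r' hr' hW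
    have h := (hc r hr r' hr').2.2.trans (mul_le_mul_right hW _)
    have h' := (ENNReal.ofReal_le_iff_le_toReal (by finiteness)).1 h
    rwa [ENNReal.toReal_mul, ENNReal.coe_toReal] at h'
  have e3 := (abs_le.1 (hreal s hs q hq.1 hsW)).1
  have e4 := (abs_le.1 (hreal p hpC s' hs' hsW')).2
  have e5 := ENNReal.toReal_mono hq.klDiv_ne_top hsk
  have e6 := ENNReal.toReal_mono hpfin hsk'
  set h := midpointMeasure p s with hh
  have hhC : h ∈ Couplings (marginal p) := midpointMeasure_mem_couplings hpC hs
  have hpk : klDiv p h ≠ ∞ := klDiv_ne_top_of_le_smul (le_two_smul_midpointMeasure_left p s)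
  have hsk2 : klDiv s h ≠ ∞ := klDiv_ne_top_of_le_smul (le_two_smul_midpointMeasure_right p s)
  have hl : (0 : ℝ) ≤ lam := lam.2
  have hsum : (klDiv p h).toReal + (klDiv s h).toReal ≤ 2 * (L * δ.toReal) := by
    have hnn : 0 ≤ (klDiv p h).toReal + (klDiv s h).toReal := by positivity
    have e7 := mul_le_mul_of_nonneg_left e5 (by positivity : (0 : ℝ) ≤ lam + 1)
    have e8 := mul_le_mul_of_nonneg_left e6 (by positivity : (0 : ℝ) ≤ lam + 1)
    have e9 := mul_nonneg hl hnn
    linarith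
  have hsum' : klDiv p h + klDiv s h ≤ 2 * (L * δ) := by
    rw [← ENNReal.toReal_le_toReal (by finiteness) (by finiteness), ENNReal.toReal_add hpk hsk2,
      ENNReal.toReal_mul, ENNReal.toReal_mul]
    simpa using hsum
  calc W2 p q ≤ W2 p s + W2 s q := W2_triangle
    _ ≤ (W2 p h + W2 h s) + δ := add_le_add W2_triangle hsW
    _ ≤ (C * klDiv p h ^ (1 / 4 : ℝ) + C * klDiv s h ^ (1 / 4 : ℝ)) + δ := by
        gcongr
        · exact hTrans p hpC h hhC hpk
        · rw [W2_comm]; exact hTrans s hs h hhC hsk2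
    _ ≤ C * (2 * (L * δ) ^ (1 / 4 : ℝ)) + δ := by
        rw [← mul_add]
        gcongr
        exact rpow_quarter_add_le hsum'
    _ = _ := by
        rw [ENNReal.mul_rpow_of_nonneg _ _ (by norm_num)]
        ring

end Stability

end XiVI

theorem theoremA5 {D : ℕ} (hD : 0 < D)
    (Θ : Fin D → Set ℝ) (hΘ : ∀ i, MeasurableSet (Θ i))
    (prior : Fin D → Measure ℝ) (hprior : ∀ i, prior i ∈ XiVI.Dist (Θ i))
    (ℓ : (Fin D → ℝ) → ℝ) (hℓ : Measurable ℓ) (lam L C : ℝ≥0)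
    (qStar : Measure (Fin D → ℝ))
    (hqStar : XiVI.IsXiPosterior (Set.univ.pi Θ) ℓ (Measure.pi prior) lam qStar)
    (mTilde : Fin D → Measure ℝ) (hmTilde : ∀ i, mTilde i ∈ XiVI.Dist (Θ i))
    (hLip : XiVI.LipschitzCost ℓ L (XiVI.marginal qStar) mTilde)
    (hTrans : XiVI.TransportCost C (XiVI.marginal qStar))
    (qTilde : Measure (Fin D → ℝ))
    (hqTilde : XiVI.IsOneStepOutput ℓ lam mTilde qTilde ∨ XiVI.IsEOTOptimizer ℓ lam mTilde qTilde) :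
    XiVI.W2 qStar qTilde ≤
      XiVI.W2 (Measure.pi (XiVI.marginal qStar)) (Measure.pi mTilde) +
        2 * C * (L : ℝ≥0∞) ^ (1 / 4 : ℝ) *
          XiVI.W2 (Measure.pi (XiVI.marginal qStar)) (Measure.pi mTilde) ^ (1 / 4 : ℝ) := by
  have : ∀ i, IsProbabilityMeasure (prior i) := fun i => (hprior i).1
  have : ∀ i, IsProbabilityMeasure (mTilde i) := fun i => (hmTilde i).1
  have hac : ∀ i, mTilde i ≪ volume := fun i => (hmTilde i).2.1
  have hopt : XiVI.IsEOTOptimizer ℓ lam mTilde qTilde := by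
    refine hqTilde.elim (fun h => h.isEOTOptimizer hD hℓ hac fun q hq => ?_) id
    obtain ⟨c, hc⟩ := hLip.exists_const
    exact (hc qStar (XiVI.mem_couplings_marginal hqStar.1) q hq).2.1
  set W := XiVI.W2 (Measure.pi (XiVI.marginal qStar)) (Measure.pi mTilde) with hW
  by_cases hWt : W = ∞
  · rw [hWt, top_add]; exact le_top
  -- Optimal couplings are not needed: the estimate for couplings of cost close to `W ^ 2` passes to
  -- the limit, its right side being continuous.
  have hbound : ∀ c > W, XiVI.W2 qStar qTilde
      ≤ c + 2 * C * (L : ℝ≥0∞) ^ (1 / 4 : ℝ) * c ^ (1 / 4 : ℝ) := by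
    intro c hc
    obtain ⟨γ, h1, h2, h3⟩ := XiVI.exists_coupling_of_W2_lt hc
    refine (XiVI.W2_posterior_le_of_coupling hΘ hqStar hac hLip hTrans hopt h1 h2 rfl
      h3.ne_top).trans ?_
    gcongr
  have hfac : 2 * (C : ℝ≥0∞) * (L : ℝ≥0∞) ^ (1 / 4 : ℝ) ≠ ∞ := by finiteness
  have hcont : Continuous fun c : ℝ≥0∞ =>
      c + 2 * C * (L : ℝ≥0∞) ^ (1 / 4 : ℝ) * c ^ (1 / 4 : ℝ) :=
    continuous_id.add ((ENNReal.continuous_const_mul hfac).comp (ENNReal.continuous_rpow_const))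
  have : (nhdsWithin W (Set.Ioi W)).NeBot := nhdsGT_neBot_of_exists_gt ⟨∞, lt_top_iff_ne_top.2 hWt⟩
  exact ge_of_tendsto (x := nhdsWithin W (Set.Ioi W)) (hcont.tendsto W |>.mono_left nhdsWithin_le_nhds)
    (Filter.eventually_of_mem self_mem_nhdsWithin hbound)
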